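/- For $k\ge 1$ let $\Delta_k$ be the ideal triangle in the upper half-plane $\mathbb H^2$ with vertices $\infty,-1,0$ and marked points $-1+i$, $\frac{-k+i\sqrt k}{k+1}$, $i\sqrt k$ on its sides $[\infty,-1]$, $[-1,0]$, $[0,\infty]$; these sides are said to have type $1$, $\frac1k$ and $k$ respectively. A tile of type $k$ is an image of $\Delta_k$, with its marked points and side types, under an orientation-preserving isometry of $\mathbb H^2$. Two tiles may be glued along sides of the same type, identifying the marked points of these sides. A jigsaw is a triangulated ideal polygon obtained by gluing finitely many tiles, and its jigsaw group is the subgroup of $PSL(2,\mathbb R)$ generated by the $\pi$-rotations about the marked points of the exterior sides of the polygon. For integers $m,n\ge 1$ let $J_{m,n}$ be the jigsaw formed by the tile $\Delta_1$, followed by $m-1$ tiles of type $1$ glued successively to its left and $n$ tiles of type $4$ glued successively to its right, so that all tiles share the vertex $\infty$. Let $\Gamma_{m,n}\le PSL(2,\mathbb R)$ be its jigsaw group. **Proposition.** For all $m,n\ge1$ the group $\Gamma_{m,n}$ is non-arithmetic. That is, $\Gamma_{m,n}$ is not commensurable in $PSL(2,\mathbb R)$ with the image of $\rho(\mathcal O^1)$,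 for any totally real number field $F$, any quaternion algebra $A$ over $F$ that is split at one real place $\sigma$ of $F$ and ramified at all other real places, any embedding $\rho: A\to M_2(\mathbb R)$ of rings extending $\sigma$, and any order $\mathcal O$ of $A$, where $\mathcal O^1$ denotes the group of elements of reduced norm $1$ in $\mathcal O$. -/

import Mathlib

open scoped MatrixGroups UpperHalfPlane

noncomputable section

/-! ### Rotations and ideal triangles in the hyperbolic plane -/

namespace Jigsaw

/-- The matrix `[[a, b], [c, d]]` of determinant `1`. -/
def sl (a b c d : ℝ) (h : a * d - b * c = 1) : SL(2, ℝ) :=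
  ⟨!![a, b; c, d], by rw [Matrix.det_fin_two_of, h]⟩

section
variable (a b c d : ℝ) (h : a * d - b * c = 1)
@[simp] theorem sl_00 : sl a b c d h 0 0 = a := rfl
@[simp] theorem sl_01 : sl a b c d h 0 1 = b := rfl
@[simp] theorem sl_10 : sl a b c d h 1 0 = c := rfl
@[simp] theorem sl_11 : sl a b c d h 1 1 = d := rfl
end

/-- The rotation by angle `π` about the point `z = x + iy` of the upper half-plane, as the matrix
`(1/y) [[x, -(x² + y²)], [1, -x]]` (well defined up to sign as an isometry). -/
def piRotation (z : ℍ) : SL(2, ℝ) :=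
  sl (z.re / z.im) (-(z.re ^ 2 + z.im ^ 2) / z.im) (1 / z.im) (-z.re / z.im) (by
    have := z.im_ne_zero
    field_simp
    ring)

/-- `piRotation z` is an involution of the hyperbolic plane (its square is `-1`). -/
theorem piRotation_sq (z : ℍ) : piRotation z * piRotation z = -1 := by
  have := z.im_ne_zero
  ext i j
  rw [Matrix.SpecialLinearGroup.coe_mul]
  fin_cases i <;> fin_cases j <;> simp [piRotation, Matrix.mul_apply, Fin.sum_univ_two] <;>
    field_simp <;> ring

/-- `piRotation z` fixes `z`. -/
theorem piRotation_smul (z : ℍ) : piRotation z • z = z := by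
  have h := z.im_ne_zero
  have hc : (z.im : ℂ) ≠ 0 := by exact_mod_cast h
  have hz : (z : ℂ) = z.re + z.im * Complex.I := (Complex.re_add_im (z : ℂ)).symm
  have hI : Complex.I ^ 2 = -1 := Complex.I_sq
  apply UpperHalfPlane.ext
  rw [UpperHalfPlane.coe_specialLinearGroup_apply]
  have e : ((piRotation z) 1 0 : ℝ) * (z : ℂ) + ((piRotation z) 1 1 : ℝ) = Complex.I := by
    rw [hz]; simp [piRotation]; field_simp; ring
  simp only [Algebra.algebraMap_self, RingHom.id_apply]
  rw [e, div_eq_iff Complex.I_ne_zero]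
  rw [hz]
  simp [piRotation]
  field_simp
  ring_nf
  rw [hI]; ring

/-- The action of `SL(2, ℝ)` on the boundary `ℝ ∪ {∞}` by fractional linear transformations. -/
def bdry (g : SL(2, ℝ)) (x : OnePoint ℝ) : OnePoint ℝ := (g : GL (Fin 2) ℝ) • x

theorem bdry_infty (g : SL(2, ℝ)) :
    bdry g OnePoint.infty = if g 1 0 = 0 then OnePoint.infty else ((g 0 0 / g 1 0 : ℝ) : OnePoint ℝ) :=
  OnePoint.smul_infty_eq_ite _

theorem bdry_coe (g : SL(2, ℝ)) (x : ℝ) :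
    bdry g (x : OnePoint ℝ) = if g 1 0 * x + g 1 1 = 0 then OnePoint.infty
      else (((g 0 0 * x + g 0 1) / (g 1 0 * x + g 1 1) : ℝ) : OnePoint ℝ) :=
  OnePoint.smul_some_eq_ite

/-! ### Tiles -/

/-- The vertices `∞, -1, 0` of the ideal triangle `Δ_n`. -/
def baseVertex : Fin 3 → OnePoint ℝ :=
  ![OnePoint.infty, ((-1 : ℝ) : OnePoint ℝ), ((0 : ℝ) : OnePoint ℝ)]

/-- The marked points `-1 + i`, `(-n + i√n)/(n+1)`, `i√n` on the sides `[∞,-1]`, `[-1,0]`, `[0,∞]`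
of `Δ_n`. -/
def baseMark (n : ℕ) (hn : 0 < n) : Fin 3 → ℍ :=
  ![⟨⟨-1, 1⟩, one_pos⟩,
    ⟨⟨-n / (n + 1), √n / (n + 1)⟩, by
      have : (0 : ℝ) < n := by exact_mod_cast hn
      show 0 < √(n : ℝ) / (n + 1)
      positivity⟩,
    ⟨⟨0, √n⟩, by
      have : (0 : ℝ) < n := by exact_mod_cast hn
      show 0 < √(n : ℝ)
      positivity⟩]

/-- A tile of type `n ≥ 1`: the image `g Δ_n` of `Δ_n`, with its marked points, under an
orientation preserving isometry `g`. -/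
structure Tile where
  /-- the type `n` of the tile -/
  type : ℕ
  type_pos : 0 < type
  /-- the isometry `g` -/
  pos : SL(2, ℝ)

namespace Tile

/-- The vertices of the tile. -/
def vertex (T : Tile) (i : Fin 3) : OnePoint ℝ := bdry T.pos (baseVertex i)

/-- The marked point on the `i`-th side, which runs from `T.vertex i` to `T.vertex (i + 1)`. -/
def mark (T : Tile) (i : Fin 3) : ℍ := T.pos • baseMark T.type T.type_pos i

/-- The types `1, 1/n, n` of the three sides. -/
def sideType (T : Tile) : Fin 3 → ℚ := ![1, 1 / (T.type : ℚ), T.type]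

/-- The `i`-th side of `S` and the `j`-th side of `T` are the same geodesic, with `S` and `T` on
opposite sides of it. -/
def Abut (S : Tile) (i : Fin 3) (T : Tile) (j : Fin 3) : Prop :=
  T.vertex j = S.vertex (i + 1) ∧ T.vertex (j + 1) = S.vertex i

/-- `S` and `T` are glued along the `i`-th side of `S` and the `j`-th side of `T`: the sides are
identified, they have the same type, and the marked points are identified. -/
def Glued (S : Tile) (i : Fin 3) (T : Tile) (j : Fin 3) : Prop :=
  Abut S i T j ∧ S.sideType i = T.sideType j ∧ S.mark i = T.mark j

end Tile

/-! ### Jigsaws and their groups -/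

/-- The `i`-th side of the tile `S` is an exterior side of the collection `J` of tiles: no tile
of `J` lies on the other side of it. -/
def IsExterior (J : Set Tile) (S : Tile) (i : Fin 3) : Prop :=
  ∀ T ∈ J, ∀ j, ¬ S.Abut i T j

/-- Finite collections of tiles obtained from one tile by successively gluing a new tile to an
exterior side along matching sides. -/
inductive IsJigsaw : Set Tile → Prop
  | single (T : Tile) : IsJigsaw {T}
  | glue (J : Set Tile) (S T : Tile) (i j : Fin 3) : IsJigsaw J → S ∈ J → IsExterior J S i →
      S.Glued i T j → IsJigsaw (insert T J)

end Jigsaw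

/-- A jigsaw: a triangulated ideal polygon formed by gluing finitely many tiles. -/
structure Jigsaw where
  tiles : Set Jigsaw.Tile
  isJigsaw : Jigsaw.IsJigsaw tiles

namespace Jigsaw

/-- The jigsaw group: the subgroup of `PSL(2, ℝ)` generated by the `π`-rotations about the marked
points of the exterior sides of the jigsaw. -/
def group (J : Jigsaw) : Subgroup PSL(2, ℝ) :=
  Subgroup.closure {γ | ∃ T ∈ J.tiles, ∃ i, IsExterior J.tiles T i ∧
    γ = QuotientGroup.mk (piRotation (T.mark i))}

/-! ### The jigsaws `J_{m,n}` -/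

/-- The `k`-th tile to the left of `Δ_1` (which is the case `k = 0`): the tile of type `1` with
vertices `∞, -1-k, -k`, the translate of `Δ_1` by `-k`. -/
def typeOneTile (k : ℕ) : Tile :=
  ⟨1, one_pos, sl 1 (-(k : ℝ)) 0 1 (by ring)⟩

/-- The positions of the tiles of type `4` to the right of `Δ_1`. For `k = 3q, 3q+1, 3q+2` these
map the vertices `(∞, -1, 0)` of `Δ_4` to `(∞, 6q, 6q+1)`, `(6q+1, 6q+5, ∞)` and
`(6q+6, ∞, 6q+5)`. -/
def typeFourMatrix (q : ℝ) : Fin 3 → SL(2, ℝ) :=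
  ![sl 1 (6 * q + 1) 0 1 (by ring),
    sl ((6 * q + 1) / 2) (-2) (1 / 2) 0 (by ring),
    sl (6 * q + 6) (6 * q + 5) 1 1 (by ring)]

/-- The `k`-th tile of type `4` (`k = 0, 1, 2, …`) to the right of `Δ_1`. -/
def typeFourTile (k : ℕ) : Tile :=
  ⟨4, by norm_num, typeFourMatrix ((k / 3 : ℕ) : ℝ) (Fin.ofNat 3 k)⟩

/-- The tiles of `J_{m,n}`. -/
def tilesJ (m n : ℕ) : Set Tile :=
  {T | ∃ k < m, T = typeOneTile k} ∪ {T | ∃ k < n, T = typeFourTile k}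

/-- `T` is a vertical tile with vertices `∞, a, b` (in the cyclic order of the tile, starting at
the index `s`). -/
def Tile.IsVertical (T : Tile) (s : Fin 3) (a b : ℝ) : Prop :=
  T.vertex s = OnePoint.infty ∧ T.vertex (s + 1) = (a : OnePoint ℝ) ∧
    T.vertex (s + 2) = (b : OnePoint ℝ)

theorem Tile.mark_eq (T : Tile) (i : Fin 3) (z : ℍ)
    (h : (T.pos 0 0 : ℂ) * baseMark T.type T.type_pos i + (T.pos 0 1 : ℂ)
      = z * ((T.pos 1 0 : ℂ) * baseMark T.type T.type_pos i + (T.pos 1 1 : ℂ))) :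
    T.mark i = z := by
  apply UpperHalfPlane.ext
  rw [mark, UpperHalfPlane.coe_specialLinearGroup_apply]
  simp only [Algebra.algebraMap_self, RingHom.id_apply]
  rw [div_eq_iff, h]
  exact UpperHalfPlane.denom_ne_zero (T.pos : GL (Fin 2) ℝ) (baseMark T.type T.type_pos i)

theorem typeOneTile_isVertical (k : ℕ) : (typeOneTile k).IsVertical 0 (-1 - k) (-k) := by
  refine ⟨?_, ?_, ?_⟩ <;> simp [Tile.vertex, baseVertex, typeOneTile, bdry_infty, bdry_coe]
  ring

theorem typeFourTile_eq (q : ℕ) (r : Fin 3) :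
    typeFourTile (3 * q + r) = ⟨4, by norm_num, typeFourMatrix q r⟩ := by
  have h1 : (3 * q + (r : ℕ)) / 3 = q := by omega
  have h2 : Fin.ofNat 3 (3 * q + (r : ℕ)) = r := by ext; simp
  rw [typeFourTile, h1, h2]

theorem typeFourTile_isVertical (q : ℕ) (r : Fin 3) :
    (typeFourTile (3 * q + r)).IsVertical (-r) (6 * q + ![0, 1, 5] r) (6 * q + ![1, 5, 6] r) := by
  rw [typeFourTile_eq]
  fin_cases r <;> refine ⟨?_, ?_, ?_⟩ <;>
    simp [Tile.vertex, baseVertex, typeFourMatrix, bdry_infty, bdry_coe,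
      show (-1 + 2 : Fin 3) = 1 from rfl, show (-2 + 1 : Fin 3) = 2 from rfl] <;> ring_nf

theorem Tile.IsVertical.abut {S T : Tile} {s t : Fin 3} {a b c : ℝ} (hS : S.IsVertical s a b)
    (hT : T.IsVertical t b c) : S.Abut (s + 2) T t := by
  have : s + 2 + 1 = s := by omega
  exact ⟨by rw [hT.1, this, hS.1], by rw [hT.2.1, hS.2.2]⟩

theorem Tile.IsVertical.isExterior_right {J : Set Tile} {S : Tile} {s : Fin 3} {a b : ℝ}
    (hS : S.IsVertical s a b)
    (hJ : ∀ T ∈ J, ∃ t c d, T.IsVertical t c d ∧ c ≠ b) : IsExterior J S (s + 2) := by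
  rintro T hT j ⟨h1, h2⟩
  obtain ⟨t, c, d, hv, hne⟩ := hJ T hT
  have : s + 2 + 1 = s := by omega
  rw [this, hS.1] at h1
  rw [hS.2.2] at h2
  have hj : j = t ∨ j = t + 1 ∨ j = t + 2 := by omega
  rcases hj with rfl | rfl | rfl
  · rw [hv.2.1] at h2; exact hne (by simpa using h2)
  · rw [hv.2.1] at h1; simp at h1
  · rw [hv.2.2] at h1; simp at h1

theorem Tile.IsVertical.isExterior_left {J : Set Tile} {S : Tile} {s : Fin 3} {a b : ℝ}
    (hS : S.IsVertical s a b)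
    (hJ : ∀ T ∈ J, ∃ t c d, T.IsVertical t c d ∧ d ≠ a) : IsExterior J S s := by
  rintro T hT j ⟨h1, h2⟩
  obtain ⟨t, c, d, hv, hne⟩ := hJ T hT
  rw [hS.1] at h2
  rw [hS.2.1] at h1
  have hj : j = t ∨ j = t + 1 ∨ j = t + 2 := by omega
  rcases hj with rfl | rfl | rfl
  · rw [hv.1] at h1; simp at h1
  · have : t + 1 + 1 = t + 2 := by omega
    rw [this, hv.2.2] at h2; simp at h2
  · rw [hv.2.2] at h1; exact hne (by simpa using h1)

theorem Tile.IsVertical.glued {S T : Tile} {s t : Fin 3} {a b c : ℝ} (hS : S.IsVertical s a b)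
    (hT : T.IsVertical t b c) (h : S.sideType (s + 2) = T.sideType t)
    (hm : S.mark (s + 2) = T.mark t) : S.Glued (s + 2) T t :=
  ⟨hS.abut hT, h, hm⟩

theorem typeOneTile_glued (k : ℕ) : (typeOneTile k).Glued 0 (typeOneTile (k + 1)) 2 := by
  have h := typeOneTile_isVertical (k + 1)
  have e : -((k + 1 : ℕ) : ℝ) = -1 - k := by push_cast; ring
  rw [e] at h
  have h2 := h.abut (typeOneTile_isVertical k)
  refine ⟨⟨h2.2.symm, h2.1.symm⟩, by simp [Tile.sideType, typeOneTile], ?_⟩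
  trans ⟨⟨-1 - k, 1⟩, one_pos⟩
  · apply Tile.mark_eq
    apply Complex.ext <;> simp [typeOneTile, baseMark]; ring
  · symm
    apply Tile.mark_eq
    apply Complex.ext <;> simp [typeOneTile, baseMark]; ring

theorem typeFourTile_mark (q : ℕ) (r : Fin 3) :
    (typeFourTile (3 * q + r)).mark (-r) = ⟨⟨6 * q + ![0, 1, 5] r, ![1, 2, 2] r⟩, by
      fin_cases r <;> norm_num⟩ ∧
    (typeFourTile (3 * q + r)).mark (-r + 2) = ⟨⟨6 * q + ![1, 5, 6] r, ![2, 2, 1] r⟩, by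
      fin_cases r <;> norm_num⟩ := by
  have h4 : √(4 : ℝ) = 2 := by
    rw [show (4 : ℝ) = 2 ^ 2 by norm_num]; exact Real.sqrt_sq (by norm_num)
  rw [typeFourTile_eq]
  constructor <;> apply Tile.mark_eq <;> fin_cases r <;>
    simp [typeFourMatrix, baseMark, show (-1 + 2 : Fin 3) = 1 from rfl,
      show (-2 + 2 : Fin 3) = 0 from rfl] <;> apply Complex.ext <;> simp [h4] <;> ring_nf

/-- The left endpoint of `typeFourTile k`. -/
def cut (k : ℕ) : ℕ := k + 3 * ((k + 1) / 3)

theorem cut_strictMono : StrictMono cut := strictMono_nat_of_lt_succ fun k => by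
  unfold cut; omega

theorem cut_eq (q : ℕ) : (cut (3 * q) : ℝ) = 6 * q ∧ (cut (3 * q + 1) : ℝ) = 6 * q + 1 ∧
    (cut (3 * q + 2) : ℝ) = 6 * q + 5 ∧ (cut (3 * q + 3) : ℝ) = 6 * q + 6 := by
  refine ⟨?_, ?_, ?_, ?_⟩ <;> norm_cast <;> unfold cut <;> omega

theorem typeFourTile_sideType (k : ℕ) : (typeFourTile k).sideType = ![1, 1 / 4, 4] := by
  simp [Tile.sideType, typeFourTile]

theorem typeFourTile_glued (k : ℕ) : ∃ s t, (typeFourTile k).IsVertical s (cut k) (cut (k + 1)) ∧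
    (typeFourTile k).Glued (s + 2) (typeFourTile (k + 1)) t := by
  obtain ⟨q, r, hr, rfl⟩ : ∃ q r, r < 3 ∧ k = 3 * q + r :=
    ⟨k / 3, k % 3, Nat.mod_lt _ (by norm_num), (Nat.div_add_mod k 3).symm⟩
  obtain ⟨c0, c1, c2, c3⟩ := cut_eq q
  have v0 := typeFourTile_isVertical q 0
  have v1 := typeFourTile_isVertical q 1
  have v2 := typeFourTile_isVertical q 2
  have v3 := typeFourTile_isVertical (q + 1) 0
  have m0 := (typeFourTile_mark q 0).2
  have m1 := typeFourTile_mark q 1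
  have m2 := typeFourTile_mark q 2
  have m3 := (typeFourTile_mark (q + 1) 0).1
  have e : 6 * ((q + 1 : ℕ) : ℝ) = 6 * q + 6 := by push_cast; ring
  simp only [Fin.val_zero, Fin.val_one, Fin.val_two, Matrix.cons_val, add_zero, e] at *
  interval_cases r
  · rw [← c1, ← c0] at v0
    rw [← c1] at v1
    refine ⟨_, _, v0, v0.glued v1 ?_ (m0.trans m1.1.symm)⟩
    simp [typeFourTile_sideType, show (-1 : Fin 3) = 2 from rfl]
  · rw [← c1, ← c2] at v1
    rw [← c2] at v2
    refine ⟨_, _, v1, v1.glued v2 ?_ (m1.2.trans m2.1.symm)⟩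
    simp [typeFourTile_sideType, show (-1 + 2 : Fin 3) = 1 from rfl,
      show (-2 : Fin 3) = 1 from rfl]
  · rw [← c2, ← c3] at v2
    rw [← c3] at v3
    refine ⟨_, _, v2, v2.glued v3 ?_ (m2.2.trans m3.symm)⟩
    simp [typeFourTile_sideType, show (-2 + 2 : Fin 3) = 0 from rfl]

theorem typeOne_typeFour_glued : (typeOneTile 0).Glued 2 (typeFourTile 0) 0 := by
  have h1 := typeOneTile_isVertical 0
  have h2 := typeFourTile_isVertical 0 0
  have h3 := (typeFourTile_mark 0 0).1
  simp only [Fin.val_zero, Matrix.cons_val, add_zero, Nat.cast_zero, mul_zero, neg_zero] at *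
  refine h1.glued h2 ?_ ?_
  · simp [Tile.sideType, typeOneTile, typeFourTile]
  · rw [h3]
    apply Tile.mark_eq
    apply Complex.ext <;> simp [typeOneTile, baseMark]

theorem isJigsaw_left (m : ℕ) (hm : 1 ≤ m) : IsJigsaw {T | ∃ k < m, T = typeOneTile k} := by
  induction m, hm using Nat.le_induction with
  | base =>
    convert IsJigsaw.single (typeOneTile 0)
    ext T; simp
  | succ m hm ih =>
    obtain ⟨l, rfl⟩ : ∃ l, m = l + 1 := ⟨m - 1, by omega⟩
    convert IsJigsaw.glue _ (typeOneTile l) (typeOneTile (l + 1)) 0 2 ih ⟨l, by omega, rfl⟩ ?_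
      (typeOneTile_glued l)
    · ext T
      simp only [Set.mem_ofPred_eq, Set.mem_insert_iff]
      constructor
      · rintro ⟨k, hk, rfl⟩
        rcases Nat.lt_succ_iff_lt_or_eq.mp hk with h | h
        · exact Or.inr ⟨k, h, rfl⟩
        · exact Or.inl (by rw [h])
      · rintro (rfl | ⟨k, hk, rfl⟩)
        · exact ⟨l + 1, by omega, rfl⟩
        · exact ⟨k, by omega, rfl⟩
    · apply (typeOneTile_isVertical l).isExterior_left
      rintro T ⟨k, hk, rfl⟩
      refine ⟨_, _, _, typeOneTile_isVertical k, ?_⟩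
      have : (k : ℝ) < l + 1 := by exact_mod_cast hk
      intro h; linarith

theorem isJigsaw_tilesJ (m n : ℕ) (hm : 1 ≤ m) : IsJigsaw (tilesJ m n) := by
  induction n with
  | zero =>
    convert isJigsaw_left m hm
    ext T; simp [tilesJ]
  | succ n ih =>
    have hset : tilesJ m (n + 1) = insert (typeFourTile n) (tilesJ m n) := by
      ext T
      simp only [tilesJ, Set.mem_union, Set.mem_ofPred_eq, Set.mem_insert_iff]
      constructor
      · rintro (h | ⟨k, hk, rfl⟩)
        · exact Or.inr (Or.inl h)
        · rcases Nat.lt_succ_iff_lt_or_eq.mp hk with h | h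
          · exact Or.inr (Or.inr ⟨k, h, rfl⟩)
          · exact Or.inl (by rw [h])
      · rintro (rfl | h | ⟨k, hk, rfl⟩)
        · exact Or.inr ⟨n, by omega, rfl⟩
        · exact Or.inl h
        · exact Or.inr ⟨k, by omega, rfl⟩
    rw [hset]
    have hleft : ∀ x : ℕ, (∀ k < n, cut k < x) →
        ∀ T ∈ tilesJ m n, ∃ t c d, T.IsVertical t c d ∧ c ≠ (x : ℝ) := by
      rintro x hx T (⟨k, hk, rfl⟩ | ⟨k, hk, rfl⟩)
      · refine ⟨_, _, _, typeOneTile_isVertical k, ?_⟩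
        have h1 : (0 : ℝ) ≤ k := k.cast_nonneg
        have h2 : (0 : ℝ) ≤ x := x.cast_nonneg
        intro h; linarith
      · obtain ⟨s, t, hs, -⟩ := typeFourTile_glued k
        refine ⟨_, _, _, hs, ?_⟩
        exact_mod_cast (hx k hk).ne
    rcases Nat.eq_zero_or_pos n with rfl | hn
    · refine IsJigsaw.glue _ (typeOneTile 0) _ 2 0 ih (Or.inl ⟨0, by omega, rfl⟩) ?_
        typeOne_typeFour_glued
      refine (typeOneTile_isVertical 0).isExterior_right ?_
      simpa using hleft 0 (by simp)
    · obtain ⟨l, rfl⟩ : ∃ l, n = l + 1 := ⟨n - 1, by omega⟩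
      obtain ⟨s, t, hv, hg⟩ := typeFourTile_glued l
      refine IsJigsaw.glue _ (typeFourTile l) _ _ _ ih (Or.inr ⟨l, by omega, rfl⟩) ?_ hg
      exact hv.isExterior_right (hleft _ fun k hk => cut_strictMono hk)

/-- The jigsaw `J_{m,n}`, consisting of `m` tiles of type `1` followed, from left to right, by `n`
tiles of type `4`; the last of the tiles of type `1` is `Δ_1`, and all tiles have the vertex `∞`. -/
def J (m n : ℕ) (hm : 1 ≤ m) : Jigsaw := ⟨tilesJ m n, isJigsaw_tilesJ m n hm⟩

end Jigsaw

/-! ### Arithmetic Fuchsian groups -/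

namespace ArithmeticFuchsian

open NumberField

/-- `O` is an order of the quaternion algebra `(a,b / F)` over the number field `F`: a subring
containing the ring of integers `𝓞 F`, finitely generated as a module, which spans the algebra
over `F`. (Being finitely generated over `𝓞 F` and over `ℤ` are the same thing, as `𝓞 F` is
finitely generated over `ℤ`.) -/
structure IsOrder {F : Type} [Field F] [NumberField F] {a b : F}
    (O : Subring (QuaternionAlgebra F a 0 b)) : Prop where
  algebraMap_mem : ∀ c : 𝓞 F, algebraMap F (QuaternionAlgebra F a 0 b) c ∈ O
  finite : Module.Finite ℤ O
  span_eq_top : Submodule.span F (O : Set (QuaternionAlgebra F a 0 b)) = ⊤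

theorem isIntegral_add_of_comm {A : Type} [Ring A] {x y : A} (h : x * y = y * x)
    (hx : IsIntegral ℤ x) (hy : IsIntegral ℤ y) : IsIntegral ℤ (x + y) := by
  have hc : ∀ a ∈ ({x, y} : Set A), ∀ b ∈ ({x, y} : Set A), a * b = b * a := by
    rintro a (rfl | rfl) b (rfl | rfl) <;> simp [h]
  let _ : CommRing (Algebra.adjoin ℤ {x, y}) :=
    { (Algebra.adjoin ℤ {x, y}).toRing with
      mul_comm := (Algebra.isMulCommutative_adjoin ℤ hc).is_comm.comm }
  have hx' : IsIntegral ℤ (⟨x, Algebra.subset_adjoin (by simp)⟩ : Algebra.adjoin ℤ {x, y}) :=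
    (isIntegral_algHom_iff (Algebra.adjoin ℤ {x, y}).val Subtype.val_injective).1 hx
  have hy' : IsIntegral ℤ (⟨y, Algebra.subset_adjoin (by simp)⟩ : Algebra.adjoin ℤ {x, y}) :=
    (isIntegral_algHom_iff (Algebra.adjoin ℤ {x, y}).val Subtype.val_injective).1 hy
  exact (hx'.add hy').map (Algebra.adjoin ℤ {x, y}).val

/-- An order is stable under quaternion conjugation. -/
theorem IsOrder.star_mem {F : Type} [Field F] [NumberField F] {a b : F}
    {O : Subring (QuaternionAlgebra F a 0 b)} (hO : IsOrder O)
    {x : QuaternionAlgebra F a 0 b} (hx : x ∈ O) : star x ∈ O := by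
  have := hO.finite
  have h1 : IsIntegral ℤ x :=
    (IsIntegral.of_finite ℤ (⟨x, hx⟩ : O)).map O.subtype.toIntAlgHom
  have h2 : IsIntegral ℤ (star x) := by
    obtain ⟨p, hp, hpx⟩ := h1
    refine ⟨p, hp, ?_⟩
    have := congrArg star hpx
    rw [Polynomial.eval₂_eq_sum_range] at this ⊢
    simpa [(Int.cast_commute _ _).eq] using this
  have h3 := isIntegral_add_of_comm (star_comm_self' x).symm h1 h2
  rw [QuaternionAlgebra.self_add_star', ← QuaternionAlgebra.coe_algebraMap] at h3
  have h4 : IsIntegral ℤ (2 * x.re + 0 * x.imI) :=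
    (isIntegral_algebraMap_iff QuaternionAlgebra.algebraMap_injective).1 h3
  rw [QuaternionAlgebra.star_eq_two_re_sub, ← QuaternionAlgebra.coe_algebraMap]
  exact O.sub_mem (hO.algebraMap_mem ⟨_, h4⟩) hx

/-- The group `ρ(O¹) ≤ SL(2, ℝ)`, where `O¹` is the group of elements of reduced norm
`x * star x = 1` in the order `O`, and `ρ` is a matrix representation. -/
def normOneGroup {F : Type} [Field F] [NumberField F] {a b : F}
    (O : Subring (QuaternionAlgebra F a 0 b)) (hO : IsOrder O)
    (ρ : QuaternionAlgebra F a 0 b →+* Matrix (Fin 2) (Fin 2) ℝ) : Subgroup SL(2, ℝ) where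
  carrier := {γ | ∃ x ∈ O, x * star x = 1 ∧ ρ x = γ}
  one_mem' := ⟨1, O.one_mem, by simp, by simp⟩
  mul_mem' := by
    rintro _ _ ⟨x, hx, hx1, hγ⟩ ⟨y, hy, hy1, hδ⟩
    refine ⟨x * y, O.mul_mem hx hy, ?_, by simp [hγ, hδ]⟩
    rw [star_mul, mul_assoc, ← mul_assoc y, hy1, one_mul, hx1]
  inv_mem' := by
    rintro γ ⟨x, hx, hx1, hγ⟩
    have hc : star x * x = 1 := by rw [star_comm_self', hx1]
    refine ⟨star x, hO.star_mem hx, by rw [star_star, hc], ?_⟩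
    have h1 : ρ (star x) * (γ : Matrix (Fin 2) (Fin 2) ℝ) = 1 := by
      rw [← hγ, ← map_mul, hc, map_one]
    have h2 : (γ : Matrix (Fin 2) (Fin 2) ℝ) *
        ((γ⁻¹ : SL(2, ℝ)) : Matrix (Fin 2) (Fin 2) ℝ) = 1 := by
      rw [← Matrix.SpecialLinearGroup.coe_mul, mul_inv_cancel, Matrix.SpecialLinearGroup.coe_one]
    exact left_inv_eq_right_inv h1 h2

/-- A subgroup `Γ` of `PSL(2, ℝ)` is an arithmetic Fuchsian group if it is commensurable with the
image of `ρ(O¹)` in `PSL(2, ℝ)`, where `O` is an order in a quaternion algebra `(a,b / F)` over a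
totally real number field `F` which is split at one real place `σ` of `F`, as witnessed by an
embedding `ρ` into the real `2 × 2` matrices extending `σ`, and is ramified at all other real
places `τ`. (All embeddings `ρ` over `σ` are allowed, so conjugates are included.) -/
def IsArithmetic (Γ : Subgroup PSL(2, ℝ)) : Prop :=
  ∃ (F : Type) (_ : Field F) (_ : NumberField F) (_ : IsTotallyReal F)
    (a b : F) (_ : a ≠ 0) (_ : b ≠ 0) (σ : F →+* ℝ)
    (ρ : QuaternionAlgebra F a 0 b →+* Matrix (Fin 2) (Fin 2) ℝ)
    (O : Subring (QuaternionAlgebra F a 0 b)) (hO : IsOrder O),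
    (∀ c : F, ρ (algebraMap F _ c) = algebraMap ℝ _ (σ c)) ∧
    (∀ τ : F →+* ℝ, τ ≠ σ →
      Nonempty (QuaternionAlgebra ℝ (τ a) 0 (τ b) ≃ₐ[ℝ] Quaternion ℝ)) ∧
    Subgroup.Commensurable Γ ((normOneGroup O hO ρ).map (QuotientGroup.mk' _))

end ArithmeticFuchsian

end

/-! Arithmeticity forces traces to be algebraic integers, and a single element of the jigsaw group
violates this for all `m` and `n` at once.

Integrality: let `γ` represent an element of a group commensurable with the image of `ρ(O¹)`. Some
positive power of it lies in that image, so up to sign `γ ^ k` is `ρ x` with `x` in the order, hence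
integral over `ℤ`. Then `γ` and `γ⁻¹` are integral too, and they commute, so their sum, the scalar
matrix `tr γ`, is integral (`IsArithmetic.isIntegral_trace`).

Obstruction: the tiles on the two sides of the geodesic from `0` to `∞`, of types `1` and `4`,
belong to every `J_{m,n}`, and their sides opposite `∞` are always exterior. The product of the
rotations about the marked points of these sides has trace `-9/2` (`exists_mem_group_trace`), a
rational number that is not an integer. -/

namespace Jigsaw

/-! ### An element of the jigsaw group with non-integral trace -/

/-- A tile across the side from `a` to `b` would have to traverse it from `b` to `a`. The only side
of a vertical tile that avoids `∞` runs from left to right, so no vertical tile can do this. -/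
theorem Tile.IsVertical.isExterior_bottom {J : Set Tile} {S : Tile} {s : Fin 3} {a b : ℝ}
    (hS : S.IsVertical s a b) (hab : a < b)
    (hJ : ∀ T ∈ J, ∃ t c d, T.IsVertical t c d ∧ c < d) : IsExterior J S (s + 1) := by
  rintro T hT j ⟨h1, h2⟩
  obtain ⟨t, c, d, hv, hlt⟩ := hJ T hT
  have : s + 1 + 1 = s + 2 := by omega
  rw [this, hS.2.2] at h1
  rw [hS.2.1] at h2
  have hj : j = t ∨ j = t + 1 ∨ j = t + 2 := by omega
  rcases hj with rfl | rfl | rfl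
  · rw [hv.1] at h1; simp at h1
  · have : t + 1 + 1 = t + 2 := by omega
    rw [this, hv.2.2] at h2
    rw [hv.2.1] at h1
    have h3 : c = b := by simpa using h1
    have h4 : d = a := by simpa using h2
    linarith
  · have : t + 2 + 1 = t := by omega
    rw [this, hv.1] at h2; simp at h2

/-- Every tile of `J_{m,n}` is vertical. -/
theorem isVertical_of_mem_tilesJ {m n : ℕ} {T : Tile} (hT : T ∈ tilesJ m n) :
    ∃ t c d, T.IsVertical t c d ∧ c < d := by
  rcases hT with ⟨k, -, rfl⟩ | ⟨k, -, rfl⟩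
  · exact ⟨_, _, _, typeOneTile_isVertical k, by linarith⟩
  · obtain ⟨s, t, hs, -⟩ := typeFourTile_glued k
    exact ⟨_, _, _, hs, by exact_mod_cast cut_strictMono k.lt_succ_self⟩

theorem typeOneTile_mark_one :
    (typeOneTile 0).mark 1 = ⟨⟨-1 / 2, 1 / 2⟩, by norm_num⟩ := by
  apply Tile.mark_eq
  apply Complex.ext <;> simp [typeOneTile, baseMark] <;> norm_num

theorem typeFourTile_mark_one :
    (typeFourTile 0).mark 1 = ⟨⟨1 / 5, 2 / 5⟩, by norm_num⟩ := by
  have h4 : √(4 : ℝ) = 2 := by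
    rw [show (4 : ℝ) = 2 ^ 2 by norm_num]; exact Real.sqrt_sq (by norm_num)
  apply Tile.mark_eq
  apply Complex.ext <;> simp [typeFourTile, typeFourMatrix, baseMark, h4] <;> norm_num

theorem exists_mem_group_trace (m n : ℕ) (hm : 1 ≤ m) (hn : 1 ≤ n) :
    ∃ γ : SL(2, ℝ), (QuotientGroup.mk γ : PSL(2, ℝ)) ∈ (J m n hm).group ∧
      γ 0 0 + γ 1 1 = -9 / 2 := by
  -- In both tiles `∞` is vertex `0`, so side `1` is the one opposite `∞`. The product matrix is
  -- `[[-3, 1], [7/2, -3/2]]`.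
  refine ⟨piRotation ((typeOneTile 0).mark 1) * piRotation ((typeFourTile 0).mark 1), ?_, ?_⟩
  · rw [QuotientGroup.mk_mul]
    refine mul_mem (Subgroup.subset_closure ⟨typeOneTile 0, Or.inl ⟨0, hm, rfl⟩, 1, ?_, rfl⟩)
      (Subgroup.subset_closure ⟨typeFourTile 0, Or.inr ⟨0, hn, rfl⟩, 1, ?_, rfl⟩)
    · exact (typeOneTile_isVertical 0).isExterior_bottom (by linarith)
        fun T hT => isVertical_of_mem_tilesJ hT
    · exact (typeFourTile_isVertical 0 0).isExterior_bottom (by simp)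
        fun T hT => isVertical_of_mem_tilesJ hT
  · rw [typeOneTile_mark_one, typeFourTile_mark_one, Matrix.SpecialLinearGroup.coe_mul]
    simp only [Matrix.mul_apply, Fin.sum_univ_two, piRotation, sl_00, sl_01, sl_10, sl_11,
      UpperHalfPlane.mk_re, UpperHalfPlane.mk_im]
    norm_num

end Jigsaw

/-! ### Integrality of traces in arithmetic Fuchsian groups -/

namespace ArithmeticFuchsian

theorem IsOrder.isIntegral {F : Type} [Field F] [NumberField F] {a b : F}
    {O : Subring (QuaternionAlgebra F a 0 b)} (hO : IsOrder O)
    {x : QuaternionAlgebra F a 0 b} (hx : x ∈ O) : IsIntegral ℤ x := by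
  have := hO.finite
  exact (IsIntegral.of_finite ℤ (⟨x, hx⟩ : O)).map O.subtype.toIntAlgHom

theorem isIntegral_of_mem_normOneGroup {F : Type} [Field F] [NumberField F] {a b : F}
    {O : Subring (QuaternionAlgebra F a 0 b)} {hO : IsOrder O}
    {ρ : QuaternionAlgebra F a 0 b →+* Matrix (Fin 2) (Fin 2) ℝ} {γ : SL(2, ℝ)}
    (hγ : γ ∈ normOneGroup O hO ρ) : IsIntegral ℤ (γ : Matrix (Fin 2) (Fin 2) ℝ) := by
  obtain ⟨x, hx, -, h⟩ := hγ
  rw [← h]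
  exact (hO.isIntegral hx).map ρ.toIntAlgHom

/-- Elements of `SL(2, ℝ)` with the same image in `PSL(2, ℝ)` have the same square. -/
theorem sq_eq_sq_of_mk_eq {γ δ : SL(2, ℝ)}
    (h : (QuotientGroup.mk γ : PSL(2, ℝ)) = QuotientGroup.mk δ) : γ ^ 2 = δ ^ 2 := by
  have hc := QuotientGroup.eq.1 h
  obtain ⟨r, hr, hrc⟩ := Matrix.SpecialLinearGroup.mem_center_iff.1 hc
  have hcomm : Commute γ (γ⁻¹ * δ) := (Subgroup.mem_center_iff.1 hc γ)
  -- A central element is a scalar matrix `r`, and its determinant gives `r ^ 2 = 1`.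
  have h2 : (γ⁻¹ * δ) ^ 2 = 1 := by
    ext1
    rw [Fintype.card_fin] at hr
    rw [Matrix.SpecialLinearGroup.coe_pow, ← hrc, ← map_pow, hr, map_one,
      Matrix.SpecialLinearGroup.coe_one]
  calc γ ^ 2 = (γ * (γ⁻¹ * δ)) ^ 2 := by rw [hcomm.mul_pow, h2, mul_one]
    _ = δ ^ 2 := by rw [mul_inv_cancel_left]

/-- In an arithmetic Fuchsian group, all matrices are integral over `ℤ`. -/
theorem IsArithmetic.isIntegral {Γ : Subgroup PSL(2, ℝ)} (hΓ : IsArithmetic Γ) {γ : SL(2, ℝ)}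
    (hγ : (QuotientGroup.mk γ : PSL(2, ℝ)) ∈ Γ) :
    IsIntegral ℤ (γ : Matrix (Fin 2) (Fin 2) ℝ) := by
  obtain ⟨F, _, _, _, a, b, -, -, σ, ρ, O, hO, -, -, hcomm⟩ := hΓ
  -- The intersection with the image of `ρ(O¹)` has finite index in `Γ`, so it contains a positive
  -- power of each element of `Γ`. The lift `δ` equals `γ ^ k` only up to sign; squaring removes the
  -- ambiguity.
  obtain ⟨k, hk, -, ⟨δ, hδ, hδγ⟩, -⟩ := Subgroup.exists_pow_mem_of_relIndex_ne_zero hcomm.2 hγ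
  have h : (γ ^ k) ^ 2 = δ ^ 2 :=
    sq_eq_sq_of_mk_eq (by rw [QuotientGroup.mk_pow]; exact hδγ.symm)
  refine IsIntegral.of_pow (n := k * 2) (by omega) ?_
  rw [← Matrix.SpecialLinearGroup.coe_pow, pow_mul, h, Matrix.SpecialLinearGroup.coe_pow]
  exact (isIntegral_of_mem_normOneGroup hδ).pow 2

/-- In an arithmetic Fuchsian group, all traces are algebraic integers. -/
theorem IsArithmetic.isIntegral_trace {Γ : Subgroup PSL(2, ℝ)} (hΓ : IsArithmetic Γ)
    {γ : SL(2, ℝ)} (hγ : (QuotientGroup.mk γ : PSL(2, ℝ)) ∈ Γ) :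
    IsIntegral ℤ (γ 0 0 + γ 1 1) := by
  have h1 := hΓ.isIntegral hγ
  have h2 := hΓ.isIntegral (γ := γ⁻¹) (by rw [QuotientGroup.mk_inv]; exact inv_mem hγ)
  have hc : (γ : Matrix (Fin 2) (Fin 2) ℝ) * ((γ⁻¹ : SL(2, ℝ)) : Matrix (Fin 2) (Fin 2) ℝ) =
      ((γ⁻¹ : SL(2, ℝ)) : Matrix (Fin 2) (Fin 2) ℝ) * γ := by
    rw [← Matrix.SpecialLinearGroup.coe_mul, ← Matrix.SpecialLinearGroup.coe_mul,
      mul_inv_cancel, inv_mul_cancel]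
  have h3 := isIntegral_add_of_comm hc h1 h2
  -- In determinant `1` the inverse is the adjugate, so the off-diagonal entries cancel.
  have h4 : (γ : Matrix (Fin 2) (Fin 2) ℝ) + ((γ⁻¹ : SL(2, ℝ)) : Matrix (Fin 2) (Fin 2) ℝ) =
      algebraMap ℝ _ (γ 0 0 + γ 1 1) := by
    rw [Matrix.SpecialLinearGroup.coe_inv, Matrix.adjugate_fin_two]
    ext i j
    fin_cases i <;> fin_cases j <;> simp [Matrix.algebraMap_matrix_apply, add_comm]
  rw [h4] at h3
  exact (isIntegral_algebraMap_iff (algebraMap ℝ (Matrix (Fin 2) (Fin 2) ℝ)).injective).1 h3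

end ArithmeticFuchsian

/-- For all `m, n ≥ 1`, the jigsaw group of `J_{m,n}` is non-arithmetic. -/
theorem mainTheorem4 (m n : ℕ) (hm : 1 ≤ m) (hn : 1 ≤ n) :
    ¬ ArithmeticFuchsian.IsArithmetic (Jigsaw.J m n hm).group := by
  intro hΓ
  obtain ⟨γ, hγ, htr⟩ := Jigsaw.exists_mem_group_trace m n hm hn
  have h := hΓ.isIntegral_trace hγ
  have hq : (-9 / 2 : ℝ) = algebraMap ℚ ℝ (-9 / 2) := by norm_num
  rw [htr, hq] at h
  -- A rational number integral over `ℤ` is an integer, but `-9` is odd.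
  obtain ⟨z, hz⟩ := IsIntegrallyClosed.isIntegral_iff.1
    ((isIntegral_algebraMap_iff (algebraMap ℚ ℝ).injective).1 h)
  have hz2 : (z : ℚ) * 2 = -9 := by
    rw [show (z : ℚ) = -9 / 2 from hz]; norm_num
  have : z * 2 = -9 := by exact_mod_cast hz2
  omega
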